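/- Let $K$ be a field of characteristic zero; all group schemes below are affine group schemes over $K$. For such a $G$, let $\mathrm{Lie}\,G$ be the Lie algebra of $\varepsilon$-derivations $d:\mathcal O(G)\to K$, i.e. $K$-linear maps with $d(ab)=\varepsilon(a)d(b)+\varepsilon(b)d(a)$, where $\varepsilon$ is the counit, with bracket $[d,e]=(d\otimes e)\Delta-(e\otimes d)\Delta$; a morphism $f:G\to G'$ induces $\mathrm{Lie}\,f:\mathrm{Lie}\,G\to\mathrm{Lie}\,G'$, $d\mapsto d\circ f^{*}$. Let $L$ be a Lie algebra over $K$ (of arbitrary dimension) with universal enveloping algebra $U(L)$, a cocommutative Hopf algebra in which the elements of $L$ are primitive. Let $U(L)^\circ$ be its Hopf dual: the commutative Hopf algebra of linear forms on $U(L)$ that vanish on a two-sided ideal of finite codimension. Put $\mathbf G(L)=\mathrm{Spec}\,U(L)^\circ$, and let $$\chi:L\longrightarrow \mathrm{Lie}\,\mathbf G(L),\qquad \chi(x)(a)=a(x)\quad (x\in L,\ a\in U(L)^\circ),$$ which is a morphism of Lie algebras and the unit of the adjunction between $\mathbf G$ and $\mathrm{Lie}$. **Proposition.** The morphism $\chi$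 is algebraically dense: if $i:H\to\mathbf G(L)$ is a closed subgroup scheme with $\chi(L)\subset \mathrm{Lie}\,H$ (regarded inside $\mathrm{Lie}\,\mathbf G(L)$ through $\mathrm{Lie}\,i$), then $H=\mathbf G(L)$, i.e. $i$ is an isomorphism. -/

import Mathlib

universe u

open scoped TensorProduct

namespace UniversalEnvelopingAlgebra
section HopfStructure

attribute [local instance 100] LieRing.ofAssociativeRing

variable (K : Type*) [CommRing K] (L : Type*) [LieRing L] [LieAlgebra K L]

local notation "UL" => UniversalEnvelopingAlgebra K L

theorem ι_lie_eq (x y : L) : ι K ⁅x, y⁆ = ι K x * ι K y - ι K y * ι K x := by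
  rw [LieHom.map_lie, LieRing.of_associative_ring_bracket]

/-- The comultiplication of `U(L)`, determined by `x ↦ x ⊗ 1 + 1 ⊗ x` for `x` in `L`. -/
noncomputable def comulHom : UL →ₐ[K] UL ⊗[K] UL :=
  lift K
    { toFun := fun x => ι K x ⊗ₜ[K] (1 : UL) + (1 : UL) ⊗ₜ[K] ι K x
      map_add' := fun x y => by
        rw [map_add, TensorProduct.add_tmul, TensorProduct.tmul_add]; abel
      map_smul' := fun c x => by
        simp [-ι_apply, TensorProduct.smul_tmul', TensorProduct.tmul_smul]
      map_lie' := fun {x y} => by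
        simp only [LieRing.of_associative_ring_bracket, ι_lie_eq, add_mul, mul_add,
          Algebra.TensorProduct.tmul_mul_tmul, one_mul, mul_one, TensorProduct.sub_tmul,
          TensorProduct.tmul_sub]
        abel }

/-- The counit of `U(L)`, determined by `x ↦ 0` for `x` in `L`. -/
noncomputable def counitHom : UL →ₐ[K] K := lift K 0

/-- The antipode of `U(L)`: the antiautomorphism determined by `x ↦ -x` for `x` in `L`. -/
noncomputable def antipodeHom : UL →ₐ[K] ULᵐᵒᵖ :=
  lift K
    { toFun := fun x => MulOpposite.op (-ι K x)
      map_add' := fun x y => by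
        rw [map_add, neg_add, MulOpposite.op_add]
      map_smul' := fun c x => by simp
      map_lie' := fun {x y} => by
        simp only [LieRing.of_associative_ring_bracket, ι_lie_eq, ← MulOpposite.op_mul,
          ← MulOpposite.op_sub, neg_mul_neg, neg_sub] }

@[simp] theorem comulHom_ι (x : L) :
    comulHom K L (ι K x) = ι K x ⊗ₜ[K] (1 : UL) + (1 : UL) ⊗ₜ[K] ι K x := lift_ι_apply K _ x
@[simp] theorem counitHom_ι (x : L) : counitHom K L (ι K x) = 0 := lift_ι_apply K _ x
@[simp] theorem antipodeHom_ι (x : L) :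
    antipodeHom K L (ι K x) = MulOpposite.op (-ι K x) := lift_ι_apply K _ x

variable {K L} in
/-- Two algebra morphisms out of `U(L)` that agree on `L` are equal. -/
theorem algHom_ext_ι {A : Type*} [Ring A] [Algebra K A] {f g : UL →ₐ[K] A}
    (h : ∀ x : L, f (ι K x) = g (ι K x)) : f = g :=
  hom_ext K (LieHom.ext h)

noncomputable instance instBialgebra : Bialgebra K UL :=
  Bialgebra.ofAlgHom (comulHom K L) (counitHom K L)
    (algHom_ext_ι fun x => by
      simp [-ι_apply, TensorProduct.add_tmul, TensorProduct.tmul_add, Algebra.TensorProduct.one_def,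
        add_assoc])
    (algHom_ext_ι fun x => by simp [-ι_apply])
    (algHom_ext_ι fun x => by simp [-ι_apply])

theorem comul_eq (u : UL) : Coalgebra.comul (R := K) u = comulHom K L u := rfl
theorem counit_eq (u : UL) : Coalgebra.counit (R := K) u = counitHom K L u := rfl

instance instIsCocomm : Coalgebra.IsCocomm K UL where
  comm_comp_comul := by
    have h : ((Algebra.TensorProduct.comm K UL UL).toAlgHom.comp (comulHom K L)) = comulHom K L :=
      algHom_ext_ι fun x => by simp [-ι_apply, add_comm]
    exact congrArg AlgHom.toLinearMap h

variable {K L} in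
/-- A subalgebra of `U(L)` containing `L` is everything. -/
theorem subalgebra_eq_top (S : Subalgebra K UL) (h : ∀ x : L, ι K x ∈ S) : S = ⊤ := by
  let g : L →ₗ⁅K⁆ S :=
    { toFun := fun x => ⟨ι K x, h x⟩
      map_add' := fun x y => by ext; simp
      map_smul' := fun c x => by ext; simp
      map_lie' := fun {x y} => by
        apply Subtype.ext
        simp [-ι_apply, LieRing.of_associative_ring_bracket] }
  have h2 : S.val.comp (lift K g) = AlgHom.id K UL := algHom_ext_ι fun x => by
    rw [AlgHom.comp_apply, lift_ι_apply]; rfl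
  rw [eq_top_iff]
  intro u _
  have := DFunLike.congr_fun h2 u
  rw [← show S.val (lift K g u) = u from this]
  exact (lift K g u).2

variable {K L} in
/-- `U(L)` is spanned by the words obtained from `1` by left multiplication by elements of `L`. -/
theorem left_induction {M : Submodule K UL} (h1 : (1 : UL) ∈ M)
    (hm : ∀ (x : L) (u : UL), u ∈ M → ι K x * u ∈ M) (u : UL) : u ∈ M := by
  let S : Subalgebra K UL :=
    { carrier := {a | ∀ m ∈ M, a * m ∈ M}
      mul_mem' := fun {a b} ha hb m hmm => by rw [mul_assoc]; exact ha _ (hb _ hmm)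
      add_mem' := fun {a b} ha hb m hmm => by rw [add_mul]; exact M.add_mem (ha _ hmm) (hb _ hmm)
      algebraMap_mem' := fun r m hmm => by
        rw [← Algebra.smul_def]; exact M.smul_mem _ hmm }
  have hS : S = ⊤ := subalgebra_eq_top S fun x m hmm => hm x m hmm
  have hu : u ∈ S := hS ▸ Algebra.mem_top
  simpa using hu 1 h1

variable {K L} in
/-- `U(L)` is spanned by the words obtained from `1` by right multiplication by elements of `L`. -/
theorem right_induction {M : Submodule K UL} (h1 : (1 : UL) ∈ M)
    (hm : ∀ (x : L) (u : UL), u ∈ M → u * ι K x ∈ M) (u : UL) : u ∈ M := by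
  let S : Subalgebra K UL :=
    { carrier := {a | ∀ m ∈ M, m * a ∈ M}
      mul_mem' := fun {a b} ha hb m hmm => by rw [← mul_assoc]; exact hb _ (ha _ hmm)
      add_mem' := fun {a b} ha hb m hmm => by rw [mul_add]; exact M.add_mem (ha _ hmm) (hb _ hmm)
      algebraMap_mem' := fun r m hmm => by
        rw [← Algebra.commutes, ← Algebra.smul_def]; exact M.smul_mem _ hmm }
  have hS : S = ⊤ := subalgebra_eq_top S fun x m hmm => hm x m hmm
  have hu : u ∈ S := hS ▸ Algebra.mem_top
  simpa using hu 1 h1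

/-- The antipode as a linear endomorphism of `U(L)`. -/
noncomputable def antipodeLin : UL →ₗ[K] UL :=
  (MulOpposite.opLinearEquiv K).symm.toLinearMap ∘ₗ (antipodeHom K L).toLinearMap

@[simp] theorem antipodeLin_one : antipodeLin K L 1 = 1 := by simp [-ι_apply, antipodeLin]
@[simp] theorem antipodeLin_mul (a b : UL) :
    antipodeLin K L (a * b) = antipodeLin K L b * antipodeLin K L a := by simp [-ι_apply, antipodeLin]
@[simp] theorem antipodeLin_ι (x : L) : antipodeLin K L (ι K x) = -ι K x := by simp [-ι_apply, antipodeLin]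

noncomputable instance instHopfAlgebra : HopfAlgebra K UL where
  antipode := antipodeLin K L
  mul_antipode_rTensor_comul := by
    ext u
    refine left_induction (M := LinearMap.eqLocus _ _) ?_ (fun x u _ => ?_) u
    · simp [-ι_apply, LinearMap.mem_eqLocus, Algebra.TensorProduct.one_def]
    · have key : ∀ t : UL ⊗[K] UL, LinearMap.mul' K UL ((antipodeLin K L).rTensor UL
          ((ι K x ⊗ₜ[K] (1 : UL) + (1 : UL) ⊗ₜ[K] ι K x) * t)) = 0 := by
        intro t
        induction t with
        | zero => simp
        | add a b ha hb => rw [mul_add, map_add, map_add, ha, hb, add_zero]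
        | tmul a b => simp [-ι_apply, add_mul, mul_assoc]
      simp [-ι_apply, LinearMap.mem_eqLocus, comul_eq, counit_eq, key]
  mul_antipode_lTensor_comul := by
    ext u
    refine right_induction (M := LinearMap.eqLocus _ _) ?_ (fun x u _ => ?_) u
    · simp [-ι_apply, LinearMap.mem_eqLocus, Algebra.TensorProduct.one_def]
    · have key : ∀ t : UL ⊗[K] UL, LinearMap.mul' K UL ((antipodeLin K L).lTensor UL
          (t * (ι K x ⊗ₜ[K] (1 : UL) + (1 : UL) ⊗ₜ[K] ι K x))) = 0 := by
        intro t
        induction t with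
        | zero => simp
        | add a b ha hb => rw [add_mul, map_add, map_add, ha, hb, add_zero]
        | tmul a b => simp [-ι_apply, mul_add, mul_assoc]
      simp [-ι_apply, LinearMap.mem_eqLocus, comul_eq, counit_eq, key]

end HopfStructure
end UniversalEnvelopingAlgebra

namespace HopfDual
section Pairing
open Module

variable {K : Type*} [Field K]

theorem dualDistrib_injective (V W : Type*) [AddCommGroup V] [Module K V] [AddCommGroup W]
    [Module K W] : Function.Injective (TensorProduct.dualDistrib K V W) := by
  let c := Module.Free.chooseBasis K (Dual K W)
  rw [injective_iff_map_eq_zero]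
  intro t ht
  obtain ⟨s, rfl⟩ := (TensorProduct.equivFinsuppOfBasisRight (M := Dual K V) c).symm.surjective t
  have hs : s = 0 := by
    ext k v
    have h2 : ∑ k ∈ s.support, (s k v) • c k = 0 := by
      ext w
      have := LinearMap.congr_fun ht (v ⊗ₜ[K] w)
      simpa [TensorProduct.equivFinsuppOfBasisRight_symm_apply, Finsupp.sum] using this
    by_cases hk : k ∈ s.support
    · exact linearIndependent_iff'.mp c.linearIndependent _ _ h2 k hk
    · simp [Finsupp.notMem_support_iff.mp hk]
  simp [hs]

/-- The pairing of `M ⊗ N` with `V ⊗ W` induced by `M → V*` and `N → W*`. -/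
noncomputable def pair {V W M N : Type*} [AddCommGroup V] [Module K V] [AddCommGroup W]
    [Module K W] [AddCommMonoid M] [Module K M] [AddCommMonoid N] [Module K N]
    (i : M →ₗ[K] Dual K V) (j : N →ₗ[K] Dual K W) : M ⊗[K] N →ₗ[K] Dual K (V ⊗[K] W) :=
  TensorProduct.dualDistrib K V W ∘ₗ TensorProduct.map i j

section
variable {V W M N : Type*} [AddCommGroup V] [Module K V] [AddCommGroup W]
    [Module K W] [AddCommMonoid M] [Module K M] [AddCommMonoid N] [Module K N]
    (i : M →ₗ[K] Dual K V) (j : N →ₗ[K] Dual K W)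

@[simp] theorem pair_tmul (m : M) (n : N) (v : V) (w : W) :
    pair i j (m ⊗ₜ n) (v ⊗ₜ w) = i m v * j n w := by simp [pair]

theorem pair_injective [Module.Flat K N] (hi : Function.Injective i) (hj : Function.Injective j) :
    Function.Injective (pair i j) :=
  (dualDistrib_injective V W).comp (TensorProduct.map_injective_of_flat_flat i j hi hj)
end
end Pairing

section FiniteDual
open Module Coalgebra WithConv

variable (K : Type*) [Field K] (U : Type*) [Ring U] [HopfAlgebra K U] [IsCocomm K U]

/-- A linear functional on the algebra `U` that vanishes on a two-sided ideal of finite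
codimension. -/
def VanishesOnCofiniteIdeal {K : Type*} [Field K] {U : Type*} [Ring U] [Algebra K U]
    (f : U →ₗ[K] K) : Prop :=
  ∃ I : Ideal U, I.IsTwoSided ∧ FiniteDimensional K (U ⧸ I) ∧ ∀ u ∈ I, f u = 0

theorem vanishes_of_factor {K : Type*} [Field K] {U : Type*} [Ring U] [Algebra K U]
    {B : Type*} [Ring B] [Algebra K B] [FiniteDimensional K B]
    (φ : U →ₐ[K] B) (g : B →ₗ[K] K) (f : U →ₗ[K] K) (h : ∀ u, f u = g (φ u)) :
    VanishesOnCofiniteIdeal f := by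
  refine ⟨RingHom.ker φ, inferInstance, ?_, fun u hu => ?_⟩
  · let l : (U ⧸ RingHom.ker φ) →ₗ[K] B :=
      ((RingHom.ker φ).restrictScalars K).liftQ φ.toLinearMap (fun u hu => hu)
    refine Module.Finite.of_injective l ?_
    rw [← LinearMap.ker_eq_bot]
    exact Submodule.ker_liftQ_eq_bot _ _ _ (fun u hu => hu)
  · rw [h, show φ u = 0 from hu, map_zero]

theorem exists_factor {K : Type*} [Field K] {U : Type*} [Ring U] [Algebra K U]
    {f : U →ₗ[K] K} {I : Ideal U} [I.IsTwoSided] (hf : ∀ u ∈ I, f u = 0) :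
    ∃ g : (U ⧸ I) →ₗ[K] K, ∀ u, f u = g (Ideal.Quotient.mkₐ K I u) :=
  ⟨(I.restrictScalars K).liftQ f hf, fun _ => rfl⟩

/-- The Hopf dual `U°`, as a subalgebra of the convolution algebra `U* = Hom(U, K)`, whose product
is dual to the comultiplication of `U`. -/
noncomputable def finiteDualSubalgebra : Subalgebra K (WithConv (U →ₗ[K] K)) where
  carrier := {f | VanishesOnCofiniteIdeal f.ofConv}
  mul_mem' := by
    rintro f g ⟨I, hI, hI', hf⟩ ⟨J, hJ, hJ', hg⟩
    obtain ⟨f', hf'⟩ := exists_factor hf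
    obtain ⟨g', hg'⟩ := exists_factor hg
    refine vanishes_of_factor ((Algebra.TensorProduct.map (Ideal.Quotient.mkₐ K I)
      (Ideal.Quotient.mkₐ K J)).comp (Bialgebra.comulAlgHom K U))
      (LinearMap.mul' K K ∘ₗ TensorProduct.map f' g') _ fun u => ?_
    have key : ∀ t : U ⊗[K] U, LinearMap.mul' K K (TensorProduct.map f.ofConv g.ofConv t) =
        LinearMap.mul' K K (TensorProduct.map f' g' (Algebra.TensorProduct.map
          (Ideal.Quotient.mkₐ K I) (Ideal.Quotient.mkₐ K J) t)) := by
      intro t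
      induction t with
      | zero => simp
      | add a b ha hb => simp only [map_add, ha, hb]
      | tmul a b => simp only [TensorProduct.map_tmul, Algebra.TensorProduct.map_tmul, hf', hg']
    exact key _
  add_mem' := by
    rintro f g ⟨I, hI, hI', hf⟩ ⟨J, hJ, hJ', hg⟩
    obtain ⟨f', hf'⟩ := exists_factor hf
    obtain ⟨g', hg'⟩ := exists_factor hg
    refine vanishes_of_factor ((Ideal.Quotient.mkₐ K I).prod (Ideal.Quotient.mkₐ K J))
      (f'.coprod g') _ fun u => ?_
    rw [ofConv_add, LinearMap.add_apply, hf', hg']; rfl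
  algebraMap_mem' := fun r =>
    vanishes_of_factor (Bialgebra.counitAlgHom K U) (r • LinearMap.id) _ fun u => by
      simp [LinearMap.convAlgebraMap_apply]

/-- The Hopf dual `U°` of a cocommutative Hopf algebra `U`. -/
def FiniteDual : Type _ := finiteDualSubalgebra K U

noncomputable instance : CommRing (FiniteDual K U) :=
  inferInstanceAs (CommRing (finiteDualSubalgebra K U))

noncomputable instance : Algebra K (FiniteDual K U) :=
  inferInstanceAs (Algebra K (finiteDualSubalgebra K U))

variable {K U}

/-- An element of the Hopf dual as a linear functional. -/
noncomputable def FiniteDual.toDual : FiniteDual K U →ₗ[K] Dual K U where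
  toFun f := f.1.ofConv
  map_add' _ _ := rfl
  map_smul' _ _ := rfl

theorem FiniteDual.toDual_injective :
    Function.Injective (FiniteDual.toDual : FiniteDual K U →ₗ[K] Dual K U) :=
  fun _ _ h => Subtype.ext (WithConv.ext h)

noncomputable instance : FunLike (FiniteDual K U) U K where
  coe f := FiniteDual.toDual f
  coe_injective _ _ h := FiniteDual.toDual_injective (DFunLike.coe_injective h)

namespace FiniteDual

theorem toDual_apply (f : FiniteDual K U) (u : U) : toDual f u = f u := rfl

@[ext] theorem ext {f g : FiniteDual K U} (h : ∀ u, f u = g u) : f = g := DFunLike.ext _ _ h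

theorem vanishes (f : FiniteDual K U) : VanishesOnCofiniteIdeal (toDual f) := f.2

/-- A functional vanishing on a cofinite ideal, as an element of the Hopf dual. -/
noncomputable def mk (f : U →ₗ[K] K) (hf : VanishesOnCofiniteIdeal f) : FiniteDual K U := ⟨toConv f, hf⟩

@[simp] theorem mk_apply (f : U →ₗ[K] K) (hf : VanishesOnCofiniteIdeal f) (u : U) :
    mk f hf u = f u := rfl
@[simp] theorem add_apply (f g : FiniteDual K U) (u : U) : (f + g) u = f u + g u := rfl
@[simp] theorem smul_apply (c : K) (f : FiniteDual K U) (u : U) : (c • f) u = c * f u := rfl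
@[simp] theorem one_apply (u : U) : (1 : FiniteDual K U) u = counit (R := K) u := by
  change (1 : WithConv (U →ₗ[K] K)) u = _
  simp
theorem mul_apply (f g : FiniteDual K U) (u : U) :
    (f * g) u = LinearMap.mul' K K (TensorProduct.map (toDual f) (toDual g) (comul u)) := rfl

/-- The pairing of `U° ⊗ U°` with `U ⊗ U`. -/
noncomputable abbrev pair₂ : FiniteDual K U ⊗[K] FiniteDual K U →ₗ[K] Dual K (U ⊗[K] U) :=
  pair toDual toDual

theorem pair₂_injective : Function.Injective (pair₂ : FiniteDual K U ⊗[K] FiniteDual K U →ₗ[K] _) :=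
  pair_injective _ _ toDual_injective toDual_injective

/-- The functional `u ⊗ v ↦ f (u v)`. -/
noncomputable def mulDual : FiniteDual K U →ₗ[K] Dual K (U ⊗[K] U) :=
  (LinearMap.mul' K U).dualMap ∘ₗ toDual

@[simp] theorem mulDual_tmul (f : FiniteDual K U) (u v : U) :
    mulDual f (u ⊗ₜ v) = f (u * v) := by simp [mulDual, toDual_apply]

theorem mulDual_mem (f : FiniteDual K U) : mulDual f ∈ LinearMap.range (pair₂ (K := K) (U := U)) := by
  obtain ⟨I, hI, hI', hf⟩ := f.vanishes
  obtain ⟨g, hg⟩ := exists_factor hf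
  let q : Dual K (U ⧸ I) →ₗ[K] FiniteDual K U :=
    { toFun := fun h => mk (h ∘ₗ (Ideal.Quotient.mkₐ K I).toLinearMap)
        (vanishes_of_factor (Ideal.Quotient.mkₐ K I) h _ fun _ => rfl)
      map_add' := fun _ _ => rfl
      map_smul' := fun _ _ => rfl }
  obtain ⟨t, ht⟩ := (TensorProduct.dualDistribEquiv K (U ⧸ I) (U ⧸ I)).surjective
    (g ∘ₗ LinearMap.mul' K (U ⧸ I))
  have key : ∀ s : Dual K (U ⧸ I) ⊗[K] Dual K (U ⧸ I), ∀ u v : U,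
      pair₂ (TensorProduct.map q q s) (u ⊗ₜ v) = TensorProduct.dualDistrib K _ _ s
        (Ideal.Quotient.mkₐ K I u ⊗ₜ Ideal.Quotient.mkₐ K I v) := by
    intro s u v
    induction s with
    | zero => simp
    | add a b ha hb => simp only [map_add, LinearMap.add_apply, ha, hb]
    | tmul a b =>
      rw [TensorProduct.map_tmul, pair_tmul, TensorProduct.dualDistrib_apply]; rfl
  refine ⟨TensorProduct.map q q t, ?_⟩
  ext u v
  have ht' : TensorProduct.dualDistrib K _ _ t = g ∘ₗ LinearMap.mul' K (U ⧸ I) := ht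
  have hm : f (u * v) = g (Ideal.Quotient.mkₐ K I u * Ideal.Quotient.mkₐ K I v) :=
    (hg (u * v)).trans (by rw [map_mul])
  simpa [key, ht', toDual_apply] using hm.symm

/-- The comultiplication of `U°`, dual to the product of `U`: `Δ f` is the unique element of
`U° ⊗ U°` whose pairing with `u ⊗ v` is `f (u v)`. -/
noncomputable def comulLin : FiniteDual K U →ₗ[K] FiniteDual K U ⊗[K] FiniteDual K U :=
  (LinearEquiv.ofInjective pair₂ pair₂_injective).symm.toLinearMap ∘ₗ
    mulDual.codRestrict _ mulDual_mem

theorem pair₂_comulLin (f : FiniteDual K U) : pair₂ (comulLin f) = mulDual f := by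
  simp [comulLin]

/-- The counit of `U°` is evaluation at `1`. -/
noncomputable def counitLin : FiniteDual K U →ₗ[K] K where
  toFun f := f 1
  map_add' _ _ := rfl
  map_smul' _ _ := rfl

@[simp] theorem counitLin_apply (f : FiniteDual K U) : counitLin f = f 1 := rfl

theorem counit_left (t : FiniteDual K U ⊗[K] FiniteDual K U) (u : U) :
    TensorProduct.lid K _ (counitLin.rTensor _ t) u = pair₂ t (1 ⊗ₜ u) := by
  induction t with
  | zero => simp; rfl
  | add a b ha hb => simp [ha, hb]
  | tmul a b => simp [toDual_apply]

theorem counit_right (t : FiniteDual K U ⊗[K] FiniteDual K U) (u : U) :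
    TensorProduct.rid K _ (counitLin.lTensor _ t) u = pair₂ t (u ⊗ₜ 1) := by
  induction t with
  | zero => simp; rfl
  | add a b ha hb => simp [ha, hb]
  | tmul a b => simp [toDual_apply, mul_comm]

noncomputable instance : Coalgebra K (FiniteDual K U) where
  comul := comulLin
  counit := counitLin
  coassoc := by
    have h1 : ∀ (t : FiniteDual K U ⊗[K] FiniteDual K U) (u v w : U),
        pair toDual pair₂ (TensorProduct.assoc K _ _ _ (comulLin.rTensor _ t))
          (u ⊗ₜ (v ⊗ₜ w)) = pair₂ t ((u * v) ⊗ₜ w) := by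
      intro t u v w
      induction t with
      | zero => simp
      | add a b ha hb => simp only [map_add, LinearMap.add_apply, ha, hb]
      | tmul a b =>
        have h : ∀ s : FiniteDual K U ⊗[K] FiniteDual K U,
            pair toDual pair₂ (TensorProduct.assoc K _ _ _ (s ⊗ₜ b)) (u ⊗ₜ (v ⊗ₜ w)) =
            pair₂ s (u ⊗ₜ v) * b w := by
          intro s
          induction s with
          | zero => simp
          | add a b ha hb =>
            simp only [TensorProduct.add_tmul, map_add, LinearMap.add_apply, ha, hb, add_mul]
          | tmul c d => simp [toDual_apply, mul_assoc]
        simp [h, pair₂_comulLin, toDual_apply]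
    have h2 : ∀ (t : FiniteDual K U ⊗[K] FiniteDual K U) (u v w : U),
        pair toDual pair₂ (comulLin.lTensor _ t)
          (u ⊗ₜ (v ⊗ₜ w)) = pair₂ t (u ⊗ₜ (v * w)) := by
      intro t u v w
      induction t with
      | zero => simp
      | add a b ha hb => simp only [map_add, LinearMap.add_apply, ha, hb]
      | tmul a b => simp [pair₂_comulLin, toDual_apply]
    refine LinearMap.ext fun f => pair_injective _ _ toDual_injective pair₂_injective ?_
    refine TensorProduct.ext <| LinearMap.ext fun u => TensorProduct.ext <|
      LinearMap.ext fun v => LinearMap.ext fun w => ?_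
    simp [h1, h2, pair₂_comulLin, mul_assoc]
  rTensor_counit_comp_comul := by
    refine LinearMap.ext fun f => (TensorProduct.lid K _).injective (FiniteDual.ext fun u => ?_)
    simp [counit_left, pair₂_comulLin]
  lTensor_counit_comp_comul := by
    refine LinearMap.ext fun f => (TensorProduct.rid K _).injective (FiniteDual.ext fun u => ?_)
    simp [counit_right, pair₂_comulLin]

theorem comul_eq (f : FiniteDual K U) : comul (R := K) f = comulLin f := rfl
theorem counit_eq (f : FiniteDual K U) : counit (R := K) f = f 1 := rfl

/-- The defining property of the comultiplication of `U°`. -/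
theorem pair₂_comul (f : FiniteDual K U) (u v : U) :
    pair₂ (comul (R := K) f) (u ⊗ₜ v) = f (u * v) := by
  rw [comul_eq, pair₂_comulLin, mulDual_tmul]

/-- The product of `U°` in terms of the pairing. -/
theorem mul_apply' (f g : FiniteDual K U) (u : U) :
    (f * g) u = pair₂ (f ⊗ₜ g) (comul u) := by
  rw [mul_apply]
  generalize comul (R := K) u = t
  induction t with
  | zero => simp
  | add a b ha hb => simp only [map_add, ha, hb]
  | tmul a b => simp

/-- The pairing is multiplicative for the convolution product on `(U ⊗ U)*`. -/
theorem pair₂_mul (s t : FiniteDual K U ⊗[K] FiniteDual K U) (x : U ⊗[K] U) :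
    pair₂ (s * t) x = (toConv (pair₂ s) * toConv (pair₂ t)) x := by
  induction s with
  | zero => simp
  | add a b ha hb => simp only [add_mul, map_add, LinearMap.add_apply, ha, hb, toConv_add]; rfl
  | tmul a b =>
    induction t with
    | zero => simp
    | add c d hc hd => simp only [mul_add, map_add, LinearMap.add_apply, hc, hd, toConv_add]; rfl
    | tmul c d =>
      induction x with
      | zero => simp
      | add u v hu hv => simp only [map_add, hu, hv]
      | tmul u v =>
        rw [Algebra.TensorProduct.tmul_mul_tmul, pair_tmul, toDual_apply, toDual_apply, mul_apply',
          mul_apply', LinearMap.convMul_apply, TensorProduct.comul_tmul]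
        generalize comul (R := K) u = p
        generalize comul (R := K) v = q
        induction p with
        | zero => simp
        | add p p' hp hp' => simp only [map_add, add_mul, TensorProduct.add_tmul, hp, hp']
        | tmul p p' =>
          induction q with
          | zero => simp
          | add q q' hq hq' => simp only [map_add, mul_add, TensorProduct.tmul_add, hq, hq']
          | tmul q q' => simp; ring

noncomputable instance : Bialgebra K (FiniteDual K U) :=
  Bialgebra.mk' K (FiniteDual K U) (by simp [counit_eq])
    (fun {f g} => by
      simp [counit_eq, mul_apply', Algebra.TensorProduct.one_def, toDual_apply])
    (pair₂_injective <| TensorProduct.ext' fun u v => by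
      rw [pair₂_comul]; simp [Algebra.TensorProduct.one_def, toDual_apply])
    (fun {f g} => pair₂_injective <| TensorProduct.ext' fun u v => by
      rw [pair₂_comul, pair₂_mul, mul_apply', Bialgebra.comul_mul, LinearMap.convMul_apply,
        TensorProduct.comul_tmul]
      generalize comul (R := K) u = p
      generalize comul (R := K) v = q
      induction p with
      | zero => simp
      | add p p' hp hp' => simp only [map_add, add_mul, TensorProduct.add_tmul, hp, hp']
      | tmul p p' =>
        induction q with
        | zero => simp
        | add q q' hq hq' => simp only [map_add, mul_add, TensorProduct.tmul_add, hq, hq']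
        | tmul q q' => simp [pair₂_comul, toDual_apply])

/-- The antipode of `U°` is dual to the antipode of `U`. -/
noncomputable def antipodeLin : FiniteDual K U →ₗ[K] FiniteDual K U where
  toFun f := mk (toDual f ∘ₗ HopfAlgebra.antipode K) (by
    obtain ⟨I, hI, hI', hf⟩ := f.vanishes
    obtain ⟨g, hg⟩ := exists_factor hf
    refine vanishes_of_factor ((AlgHom.op (Ideal.Quotient.mkₐ K I)).comp
      (HopfAlgebra.antipodeAlgHomOp K U))
      (g ∘ₗ (MulOpposite.opLinearEquiv K).symm.toLinearMap) _ fun u => ?_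
    exact hg _)
  map_add' _ _ := rfl
  map_smul' _ _ := rfl

@[simp] theorem antipodeLin_apply (f : FiniteDual K U) (u : U) :
    antipodeLin f u = f (HopfAlgebra.antipode K u) := rfl

theorem pair₂_comul' (f : FiniteDual K U) (x : U ⊗[K] U) :
    pair₂ (comul (R := K) f) x = f (LinearMap.mul' K U x) := by
  rw [comul_eq, pair₂_comulLin]; rfl

theorem apply_smul (f : FiniteDual K U) (c : K) (u : U) : f (c • u) = c * f u :=
  map_smul (toDual f) c u

noncomputable instance : HopfAlgebra K (FiniteDual K U) where
  antipode := antipodeLin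
  mul_antipode_rTensor_comul := by
    have h : ∀ (t : FiniteDual K U ⊗[K] FiniteDual K U) (u : U),
        (LinearMap.mul' K _ (antipodeLin.rTensor _ t)) u =
          pair₂ t ((HopfAlgebra.antipode K).rTensor U (comul u)) := by
      intro t u
      induction t with
      | zero => simp; rfl
      | add a b ha hb => simp [ha, hb]
      | tmul a b =>
        rw [LinearMap.rTensor_tmul, LinearMap.mul'_apply, mul_apply']
        generalize comul (R := K) u = p
        induction p with
        | zero => simp
        | add p p' hp hp' => simp only [map_add, hp, hp']
        | tmul p p' => simp [toDual_apply]
    refine LinearMap.ext fun f => FiniteDual.ext fun u => ?_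
    simp [h, pair₂_comul', counit_eq, Algebra.algebraMap_eq_smul_one, apply_smul, mul_comm]
  mul_antipode_lTensor_comul := by
    have h : ∀ (t : FiniteDual K U ⊗[K] FiniteDual K U) (u : U),
        (LinearMap.mul' K _ (antipodeLin.lTensor _ t)) u =
          pair₂ t ((HopfAlgebra.antipode K).lTensor U (comul u)) := by
      intro t u
      induction t with
      | zero => simp; rfl
      | add a b ha hb => simp [ha, hb]
      | tmul a b =>
        rw [LinearMap.lTensor_tmul, LinearMap.mul'_apply, mul_apply']
        generalize comul (R := K) u = p
        induction p with
        | zero => simp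
        | add p p' hp hp' => simp only [map_add, hp, hp']
        | tmul p p' => simp [toDual_apply]
    refine LinearMap.ext fun f => FiniteDual.ext fun u => ?_
    simp [h, pair₂_comul', counit_eq, Algebra.algebraMap_eq_smul_one, apply_smul, mul_comm]

end FiniteDual
end FiniteDual
end HopfDual

namespace HopfLie
section PointDerivations
open Coalgebra WithConv

attribute [local instance 100] LieRing.ofAssociativeRing LieAlgebra.ofAssociativeAlgebra

variable (K : Type*) [Field K] (A : Type*) [CommRing A] [HopfAlgebra K A]

theorem convMul_mul_apply {K : Type*} [Field K] {A : Type*} [CommRing A] [HopfAlgebra K A]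
    {d e : WithConv (A →ₗ[K] K)}
    (hd : ∀ a b : A, d (a * b) = counit (R := K) a * d b + counit (R := K) b * d a)
    (he : ∀ a b : A, e (a * b) = counit (R := K) a * e b + counit (R := K) b * e a) (a b : A) :
    (d * e) (a * b) = counit (R := K) a * (d * e) b + counit (R := K) b * (d * e) a +
      (d a * e b + d b * e a) := by
  have h : ∀ p q : A ⊗[K] A, LinearMap.mul' K K (TensorProduct.map d.ofConv e.ofConv (p * q)) =
      LinearMap.mul' K K (TensorProduct.map (counit (R := K)) (counit (R := K)) p) *
        LinearMap.mul' K K (TensorProduct.map d.ofConv e.ofConv q) +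
      LinearMap.mul' K K (TensorProduct.map (counit (R := K)) (counit (R := K)) q) *
        LinearMap.mul' K K (TensorProduct.map d.ofConv e.ofConv p) +
      (LinearMap.mul' K K (TensorProduct.map d.ofConv (counit (R := K)) p) *
        LinearMap.mul' K K (TensorProduct.map (counit (R := K)) e.ofConv q) +
      LinearMap.mul' K K (TensorProduct.map d.ofConv (counit (R := K)) q) *
        LinearMap.mul' K K (TensorProduct.map (counit (R := K)) e.ofConv p)) := by
    intro p q
    induction p with
    | zero => simp
    | add p p' hp hp' => simp only [map_add, add_mul, mul_add, hp, hp']; ring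
    | tmul p p' =>
      induction q with
      | zero => simp
      | add q q' hq hq' => simp only [map_add, add_mul, mul_add, hq, hq']; ring
      | tmul q q' => simp [hd, he]; ring
  have h1 : toConv (counit (R := K) (A := A)) = (1 : WithConv (A →ₗ[K] K)) := by
    ext a; simp
  have hl : ∀ (f : WithConv (A →ₗ[K] K)) (a : A),
      LinearMap.mul' K K (TensorProduct.map (counit (R := K)) f.ofConv (comul a)) = f a := by
    intro f a
    have := LinearMap.convMul_apply (toConv (counit (R := K) (A := A))) f a
    rw [h1, one_mul] at this
    exact this.symm
  have hr : ∀ (f : WithConv (A →ₗ[K] K)) (a : A),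
      LinearMap.mul' K K (TensorProduct.map f.ofConv (counit (R := K)) (comul a)) = f a := by
    intro f a
    have := LinearMap.convMul_apply f (toConv (counit (R := K) (A := A))) a
    rw [h1, mul_one] at this
    exact this.symm
  have hc : ∀ a : A, LinearMap.mul' K K (TensorProduct.map (counit (R := K)) (counit (R := K))
      (comul a)) = counit (R := K) a := fun a => hl (toConv (counit (R := K))) a
  rw [LinearMap.convMul_apply, Bialgebra.comul_mul, h, hc, hc, hr, hr, hl, hl,
    LinearMap.convMul_apply, LinearMap.convMul_apply]

/-- The `ε`-derivations `d : A → K` of a commutative Hopf algebra `A`, that is, the linear forms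
with `d (a b) = ε(a) d(b) + ε(b) d(a)`. The bracket is the commutator for the convolution product
`d * e = (d ⊗ e) ∘ Δ`. -/
def derivations : LieSubalgebra K (WithConv (A →ₗ[K] K)) where
  carrier := {d | ∀ a b : A, d (a * b) = counit (R := K) a * d b + counit (R := K) b * d a}
  add_mem' := fun {d e} hd he a b => by
    change d (a * b) + e (a * b) = _ * (d b + e b) + _ * (d a + e a)
    rw [hd, he]; ring
  zero_mem' := fun a b => by
    change (0 : K) = _ * 0 + _ * 0
    ring
  smul_mem' := fun c d hd a b => by
    change c * d (a * b) = _ * (c * d b) + _ * (c * d a)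
    rw [hd]; ring
  lie_mem' := fun {d e} hd he a b => by
    rw [LieRing.of_associative_ring_bracket]
    change (d * e) (a * b) - (e * d) (a * b) =
      _ * ((d * e) b - (e * d) b) + _ * ((d * e) a - (e * d) a)
    rw [convMul_mul_apply hd he, convMul_mul_apply he hd]; ring

/-- The Lie algebra of the affine group scheme `Spec A`, as the Lie algebra of `ε`-derivations
of `A`. -/
def LieAlg : Type _ := derivations K A

noncomputable instance : LieRing (LieAlg K A) := inferInstanceAs (LieRing (derivations K A))
noncomputable instance : LieAlgebra K (LieAlg K A) :=
  inferInstanceAs (LieAlgebra K (derivations K A))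

variable {K A}

/-- The linear form underlying an element of the Lie algebra. -/
def LieAlg.toLin (d : LieAlg K A) : A →ₗ[K] K := d.1.ofConv

/-- An `ε`-derivation as an element of the Lie algebra. -/
def LieAlg.mk (d : A →ₗ[K] K)
    (hd : ∀ a b : A, d (a * b) = counit (R := K) a * d b + counit (R := K) b * d a) :
    LieAlg K A := ⟨toConv d, hd⟩

instance : CoeFun (LieAlg K A) (fun _ => A → K) := ⟨fun d => d.toLin⟩

theorem LieAlg.ext {d e : LieAlg K A} (h : ∀ a, d a = e a) : d = e :=
  Subtype.ext (WithConv.ext (LinearMap.ext h))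

theorem LieAlg.mk_apply (d : A →ₗ[K] K)
    (hd : ∀ a b : A, d (a * b) = counit (R := K) a * d b + counit (R := K) b * d a) (a : A) :
    LieAlg.mk d hd a = d a := rfl

theorem LieAlg.map_mul (d : LieAlg K A) (a b : A) :
    d (a * b) = counit (R := K) a * d b + counit (R := K) b * d a := d.2 a b

theorem LieAlg.lie_apply (d e : LieAlg K A) (a : A) :
    ⁅d, e⁆ a = LinearMap.mul' K K (TensorProduct.map d.toLin e.toLin (comul a)) -
      LinearMap.mul' K K (TensorProduct.map e.toLin d.toLin (comul a)) := rfl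

/-- Functoriality: a morphism of Hopf algebras `φ : A → B` induces `d ↦ d ∘ φ`. -/
def LieAlg.map {B : Type*} [CommRing B] [HopfAlgebra K B] (φ : A →ₐc[K] B) :
    LieAlg K B →ₗ⁅K⁆ LieAlg K A where
  toFun d := LieAlg.mk (d.toLin ∘ₗ φ.toCoalgHom.toLinearMap) fun a b => by
    change d (φ (a * b)) = _ * d (φ b) + _ * d (φ a)
    rw [_root_.map_mul, LieAlg.map_mul, CoalgHomClass.counit_comp_apply,
      CoalgHomClass.counit_comp_apply]
  map_add' _ _ := rfl
  map_smul' _ _ := rfl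
  map_lie' := fun {d e} => LieAlg.ext fun a => by
    refine Eq.trans ?_ (LieAlg.lie_apply _ _ _).symm
    refine (LieAlg.lie_apply d e (φ a)).trans ?_
    have h : ∀ (f g : A →ₗ[K] K) (f' g' : B →ₗ[K] K) (_ : ∀ a, f a = f' (φ a))
        (_ : ∀ a, g a = g' (φ a)) (t : A ⊗[K] A),
        LinearMap.mul' K K (TensorProduct.map f' g'
          (TensorProduct.map φ.toCoalgHom.toLinearMap φ.toCoalgHom.toLinearMap t)) =
        LinearMap.mul' K K (TensorProduct.map f g t) := by
      intro f g f' g' hf hg t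
      induction t with
      | zero => simp
      | add p q hp hq => simp only [map_add, hp, hq]
      | tmul p q =>
        rw [TensorProduct.map_tmul, TensorProduct.map_tmul, TensorProduct.map_tmul,
          LinearMap.mul'_apply, LinearMap.mul'_apply, hf, hg]; rfl
    have hc : comul (R := K) (φ a) =
        TensorProduct.map φ.toCoalgHom.toLinearMap φ.toCoalgHom.toLinearMap (comul a) :=
      (CoalgHomClass.map_comp_comul_apply φ a).symm
    rw [hc]
    exact congrArg₂ (· - ·) (h _ _ _ _ (fun _ => rfl) (fun _ => rfl) _)
      (h _ _ _ _ (fun _ => rfl) (fun _ => rfl) _)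

@[simp] theorem LieAlg.map_apply {B : Type*} [CommRing B] [HopfAlgebra K B] (φ : A →ₐc[K] B)
    (d : LieAlg K B) (a : A) : LieAlg.map φ d a = d (φ a) := rfl

end PointDerivations

section Evaluation
open Coalgebra WithConv HopfDual UniversalEnvelopingAlgebra

variable (K : Type*) [Field K] (L : Type*) [LieRing L] [LieAlgebra K L]

theorem finiteDual_lie_apply (f : FiniteDual K (UniversalEnvelopingAlgebra K L)) (x y : L) :
    f (ι K ⁅x, y⁆) = f (ι K x * ι K y) - f (ι K y * ι K x) := by
  rw [ι_lie_eq]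
  exact map_sub (FiniteDual.toDual f) _ _

/-- The morphism of Lie algebras that sends `x` in `L` to the `ε`-derivation `a ↦ a(x)` of the
Hopf dual `U(L)°`. -/
noncomputable def evaluation : L →ₗ⁅K⁆ LieAlg K (FiniteDual K (UniversalEnvelopingAlgebra K L)) where
  toFun x := LieAlg.mk
      { toFun := fun a => a (ι K x)
        map_add' := fun _ _ => rfl
        map_smul' := fun _ _ => rfl } fun a b => by
      change (a * b) (ι K x) = a 1 * b (ι K x) + b 1 * a (ι K x)
      rw [FiniteDual.mul_apply', UniversalEnvelopingAlgebra.comul_eq, comulHom_ι, map_add,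
        pair_tmul, pair_tmul]
      simp only [FiniteDual.toDual_apply]
      ring
  map_add' x y := LieAlg.ext fun a => by
    change FiniteDual.toDual a (ι K (x + y)) =
      FiniteDual.toDual a (ι K x) + FiniteDual.toDual a (ι K y)
    rw [map_add, map_add]
  map_smul' c x := LieAlg.ext fun a => by
    change FiniteDual.toDual a (ι K (c • x)) = c * FiniteDual.toDual a (ι K x)
    rw [map_smul, map_smul, smul_eq_mul]
  map_lie' := fun {x y} => LieAlg.ext fun a => by
    refine Eq.trans ?_ (LieAlg.lie_apply _ _ _).symm
    change a (ι K ⁅x, y⁆) = _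
    have h : ∀ (d e : LieAlg K (FiniteDual K (UniversalEnvelopingAlgebra K L))) (u v : L)
        (_ : ∀ a, d a = a (ι K u)) (_ : ∀ a, e a = a (ι K v))
        (t : FiniteDual K (UniversalEnvelopingAlgebra K L) ⊗[K]
          FiniteDual K (UniversalEnvelopingAlgebra K L)),
        LinearMap.mul' K K (TensorProduct.map d.toLin e.toLin t) =
          FiniteDual.pair₂ t (ι K u ⊗ₜ ι K v) := by
      intro d e u v hd he t
      induction t with
      | zero => simp
      | add p q hp hq => simp only [map_add, LinearMap.add_apply, hp, hq]
      | tmul p q =>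
        rw [TensorProduct.map_tmul, LinearMap.mul'_apply, pair_tmul, hd, he]; rfl
    rw [h _ _ x y (fun _ => rfl) (fun _ => rfl), h _ _ y x (fun _ => rfl) (fun _ => rfl),
      FiniteDual.pair₂_comul, FiniteDual.pair₂_comul, finiteDual_lie_apply]

@[simp] theorem evaluation_apply (x : L) (a : FiniteDual K (UniversalEnvelopingAlgebra K L)) :
    evaluation K L x a = a (ι K x) := rfl

end Evaluation
end HopfLie

namespace AffineGroup
section CoordinateRing
open AlgebraicGeometry CategoryTheory Opposite

variable {R : CommRingCat.{u}}

/-- The coordinate ring `Γ(G, ⊤)` of an affine group scheme `G` over `R`, with its Hopf algebra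
structure. -/
noncomputable def coordHopf (G : Grp (Over (Spec R))) [IsAffine G.X.left] :
    CommHopfAlgCat.{u} R :=
  letI : GrpObj (G.X.left.asOver (Spec R)) := G.grp
  .of R Γ(G.X.left, ⊤)

/-- The canonical isomorphism of `G` with the spectrum of its coordinate ring, over `Spec R`. -/
noncomputable def isoOver (G : Grp (Over (Spec R))) [IsAffine G.X.left] :
    G.X ≅ ((hopfSpec R).obj (op (coordHopf G))).X :=
  G.X.left.isoSpec.asOver (Spec R)

instance isMonHom_isoOver (G : Grp (Over (Spec R))) [IsAffine G.X.left] : IsMonHom (isoOver G).hom := by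
  have : GrpObj (G.X.left.asOver (Spec R)) := G.grp
  constructor
  · change _ = Functor.LaxMonoidal.ε (algSpec R) ≫ (algSpec R).map (algSpec.fullyFaithful.preimage
      (Functor.OplaxMonoidal.η (algSpec R) ≫ MonObj.one ≫ (isoOver G).hom))
    rw [Functor.FullyFaithful.map_preimage]
    simp
    rfl
  · change _ = _ ≫ Functor.LaxMonoidal.μ (algSpec R) _ _ ≫ (algSpec R).map
      (algSpec.fullyFaithful.preimage (Functor.OplaxMonoidal.δ (algSpec R) _ _ ≫
        MonoidalCategoryStruct.tensorHom (isoOver G).inv (isoOver G).inv ≫ MonObj.mul ≫ (isoOver G).hom))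
    rw [Functor.FullyFaithful.map_preimage]
    simp only [Functor.Monoidal.μ_δ_assoc]
    exact ((MonoidalCategory.tensorIso (isoOver G) (isoOver G)).hom_inv_id_assoc _).symm

/-- The canonical isomorphism of group schemes of `G` with the spectrum of its coordinate ring. -/
noncomputable def isoSpecCoord (G : Grp (Over (Spec R))) [IsAffine G.X.left] :
    G ≅ (hopfSpec R).obj (op (coordHopf G)) :=
  Grp.mkIso (isoOver G) (IsMonHom.one_hom (isoOver G).hom) (IsMonHom.mul_hom (isoOver G).hom)

/-- The morphism of Hopf algebras `Γ(H, ⊤) → Γ(G, ⊤)` of a morphism of group schemes `G → H`. Its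
underlying map is the pullback of functions, see `comorphism_apply`. -/
noncomputable def comorphism {G H : Grp (Over (Spec R))} [IsAffine G.X.left] [IsAffine H.X.left]
    (f : G ⟶ H) : coordHopf H ⟶ coordHopf G :=
  ((hopfSpec R).preimage ((isoSpecCoord G).inv ≫ f ≫ (isoSpecCoord H).hom)).unop

theorem comorphism_apply {G H : Grp (Over (Spec R))} [IsAffine G.X.left] [IsAffine H.X.left]
    (f : G ⟶ H) (a : Γ(H.X.left, ⊤)) :
    (comorphism f).hom a = f.hom.hom.left.appTop.hom a := by
  have h1 := (hopfSpec R).map_preimage ((isoSpecCoord G).inv ≫ f ≫ (isoSpecCoord H).hom)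
  have h2 : Spec.map (CommRingCat.ofHom
      (RingHomClass.toRingHom (comorphism f).hom : coordHopf H →+* coordHopf G)) =
      G.X.left.isoSpec.inv ≫ f.hom.hom.left ≫ H.X.left.isoSpec.hom :=
    congrArg (fun g => g.hom.hom.left) h1
  rw [← Scheme.isoSpec_hom_naturality, Iso.inv_hom_id_assoc] at h2
  exact congrArg (fun g => g.hom a) (Spec.map_injective h2)

instance isAffine_hopfSpec (A : CommHopfAlgCat.{u} R) :
    IsAffine ((hopfSpec R).obj (op A)).X.left :=
  inferInstanceAs (IsAffine (Spec (CommRingCat.of A)))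

/-- The canonical morphism of Hopf algebras `Γ(Spec A, ⊤) → A`. Its underlying map is the usual
isomorphism, see `coordHopfSpec_apply`. -/
noncomputable def coordHopfSpec (A : CommHopfAlgCat.{u} R) :
    coordHopf ((hopfSpec R).obj (op A)) ⟶ A :=
  ((hopfSpec R).preimage (isoSpecCoord ((hopfSpec R).obj (op A))).hom).unop

theorem coordHopfSpec_apply (A : CommHopfAlgCat.{u} R) (a : Γ(Spec (CommRingCat.of A), ⊤)) :
    (coordHopfSpec A).hom a = (Scheme.ΓSpecIso (CommRingCat.of A)).hom a := by
  have h1 := (hopfSpec R).map_preimage (isoSpecCoord ((hopfSpec R).obj (op A))).hom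
  have h2 : Spec.map (CommRingCat.ofHom
      (RingHomClass.toRingHom (coordHopfSpec A).hom : coordHopf ((hopfSpec R).obj (op A)) →+* A)) =
      (Spec (CommRingCat.of A)).isoSpec.hom :=
    congrArg (fun g => g.hom.hom.left) h1
  rw [Scheme.isoSpec_Spec_hom] at h2
  exact congrArg (fun g => g.hom a) (Spec.map_injective h2)

end CoordinateRing

section Envelope
open AlgebraicGeometry CategoryTheory Opposite HopfDual HopfLie UniversalEnvelopingAlgebra

/-- Group schemes over a field `K`. -/
abbrev GroupScheme (K : Type u) [Field K] := Grp (Over (Spec (CommRingCat.of K)))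

/-- A group scheme is affine if its underlying scheme is. -/
abbrev GroupScheme.IsAff {K : Type u} [Field K] (G : GroupScheme K) : Prop := IsAffine G.X.left

/-- The ring `O(G)` of functions on an affine group scheme. -/
noncomputable abbrev coordRing {K : Type u} [Field K] (G : GroupScheme K) [G.IsAff] : Type u :=
  coordHopf G

noncomputable instance {K : Type u} [Field K] (G : GroupScheme K) [G.IsAff] :
    HopfAlgebra K (coordRing G) := (coordHopf G).hopfAlgebra

/-- The Lie algebra of an affine group scheme: the `ε`-derivations `O(G) → K`. -/
abbrev Lie {K : Type u} [Field K] (G : GroupScheme K) [G.IsAff] : Type u :=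
  LieAlg K (coordRing G)

/-- The morphism of Lie algebras `Lie f : Lie G → Lie H` of a morphism `f : G → H` of affine group
schemes. -/
noncomputable def Lie.map {K : Type u} [Field K] {G H : GroupScheme K} [G.IsAff] [H.IsAff]
    (f : G ⟶ H) : Lie G →ₗ⁅K⁆ Lie H :=
  LieAlg.map (comorphism f).hom

theorem Lie.map_apply {K : Type u} [Field K] {G H : GroupScheme K} [G.IsAff] [H.IsAff]
    (f : G ⟶ H) (d : Lie G) (a : Γ(H.X.left, ⊤)) :
    Lie.map f d a = d (f.hom.hom.left.appTop.hom a) :=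
  congrArg d.toLin (comorphism_apply f a)

/-- A morphism of Lie algebras `ρ : L → Lie G` is algebraically dense if the only closed subgroup
scheme `i : H → G` with `ρ(L) ⊆ Lie H` is `G` itself. -/
def AlgebraicallyDense {K : Type u} [Field K] {L : Type*} [LieRing L] [LieAlgebra K L]
    {G : GroupScheme K} [G.IsAff] (ρ : L →ₗ⁅K⁆ Lie G) : Prop :=
  ∀ (H : GroupScheme K) [H.IsAff] (i : H ⟶ G), IsClosedImmersion i.hom.hom.left →
    ρ.range ≤ (Lie.map i).range → IsIso i

variable (K : Type u) [Field K] (L : Type u) [LieRing L] [LieAlgebra K L]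

/-- The commutative Hopf algebra `U(L)°`. -/
noncomputable abbrev envelopeHopf : CommHopfAlgCat.{u} (CommRingCat.of K) :=
  .of (CommRingCat.of K) (FiniteDual K (UniversalEnvelopingAlgebra K L))

/-- The affine envelope `G(L) = Spec U(L)°` of the Lie algebra `L`. -/
noncomputable def affineEnvelope : GroupScheme K :=
  (hopfSpec (CommRingCat.of K)).obj (op (envelopeHopf K L))

instance : (affineEnvelope K L).IsAff := isAffine_hopfSpec (envelopeHopf K L)

variable {K L} in
/-- The map `ψ : Hom(G(L), G) → Hom(L, Lie G)` of the adjunction between `L ↦ G(L)` and `Lie`: for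
`f : G(L) → G` and `x` in `L`, the `ε`-derivation `ψ_f(x)` sends `a` in `O(G)` to `f^*(a)(x)`, the
value at `x` of the functional `f^*(a)` in `U(L)°`. -/
noncomputable def psi {G : GroupScheme K} [G.IsAff] (f : affineEnvelope K L ⟶ G) :
    L →ₗ⁅K⁆ Lie G :=
  (LieAlg.map (comorphism f ≫ coordHopfSpec (envelopeHopf K L)).hom).comp (evaluation K L)

/-- The unit `χ : L → Lie G(L)` of the adjunction: the image under `ψ` of the identity. -/
noncomputable def chi : L →ₗ⁅K⁆ Lie (affineEnvelope K L) := psi (𝟙 (affineEnvelope K L))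

theorem chi_apply (x : L) (a : Γ((affineEnvelope K L).X.left, ⊤)) :
    chi K L x a = (show FiniteDual K (UniversalEnvelopingAlgebra K L) from
      (Scheme.ΓSpecIso (CommRingCat.of (envelopeHopf K L))).hom a) (ι K x) := by
  have h : (comorphism (𝟙 (affineEnvelope K L))).hom a = a :=
    (comorphism_apply (𝟙 (affineEnvelope K L)) a).trans rfl
  have h2 := coordHopfSpec_apply (envelopeHopf K L) a
  rw [← h2, ← congrArg (coordHopfSpec (envelopeHopf K L)).hom h]
  rfl

end Envelope
end AffineGroup

/-! ### Functionals in `U(L)°` that vanish on `L` -/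

namespace HopfDual
section Density
open Coalgebra UniversalEnvelopingAlgebra TensorProduct

variable {K : Type*} [Field K]

/-! Let `C` be the coordinate ring of `G(L)`, identified with `U(L)°`, and let `I` be the kernel of
`i^* : C → O(H)`, which is surjective because `i` is a closed immersion of affine schemes.
Everything comes down to `I = 0`. An element of `Lie H`, regarded in `Lie G(L)`, is a derivation
that factors through `i^*`, so `χ(L) ⊆ Lie H` forces every functional in `I` to vanish on `L`.

This vanishing spreads from `L` to all of `U(L)`, because `i^*` is a morphism of bialgebras.
Consider the set `S` of those `u` in `U(L)` at which all functionals in `I` vanish. It is a linear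
subspace. It contains `1`, because evaluation at `1` is the counit, and the counit kills `I`. It is
closed under products: `f(uv)` is the pairing of `Δ f` with `u ⊗ v`, and `Δ I` lies in the kernel of
`i^* ⊗ i^*`, on which a product of two forms that both kill `I` is zero
(`convolution_eq_zero_of_ker`). Hence `S` is a subalgebra containing `L`, so `S = U(L)`, and the
elements of `I` are zero as functionals (`FiniteDual.eq_zero_of_forall_ι`).

Thus `i^*` is injective as well as surjective. So `i` is an isomorphism of schemes, and therefore of
group schemes (`isIso_of_isIso_left`). -/

/-- If two linear forms `p`, `q` on a bialgebra `C` vanish on the kernel of a surjective morphism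
of bialgebras, then so does their convolution product. -/
theorem convolution_eq_zero_of_ker {C B : Type*} [CommRing C] [Bialgebra K C] [CommRing B]
    [Bialgebra K B] (φ : C →ₐc[K] B) (hφ : Function.Surjective φ) (p q : C →ₗ[K] K)
    (hp : ∀ a, φ a = 0 → p a = 0) (hq : ∀ a, φ a = 0 → q a = 0) (a : C) (ha : φ a = 0) :
    LinearMap.mul' K K (TensorProduct.map p q (comul (R := K) a)) = 0 := by
  let l : C →ₗ[K] B := φ.toCoalgHom.toLinearMap
  -- Over a field the surjection has a linear section `s`. It makes explicit how a form that kills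
  -- `ker φ` descends to `B`: the descended form is `r ∘ s`, since `c - s (φ c)` lies in `ker φ`.
  obtain ⟨s, hs⟩ := l.exists_rightInverse_of_surjective (LinearMap.range_eq_top.mpr hφ)
  have factor : ∀ r : C →ₗ[K] K, (∀ a, φ a = 0 → r a = 0) → r = (r ∘ₗ s) ∘ₗ l := by
    intro r hr
    ext c
    refine sub_eq_zero.mp ((map_sub r _ _).symm.trans (hr _ ?_))
    rw [map_sub, sub_eq_zero]
    exact (LinearMap.congr_fun hs (l c)).symm
  -- The kernel of `φ` behaves as a coideal: `(φ ⊗ φ)(Δ a) = Δ(φ a) = 0`. Since `p` and `q` both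
  -- factor through `φ`, the form `p ⊗ q` factors through `φ ⊗ φ` and kills `Δ a`.
  have hc : TensorProduct.map l l (comul (R := K) a) = 0 := by
    have h : TensorProduct.map l l (comul (R := K) a) = comul (R := K) (φ a) :=
      CoalgHomClass.map_comp_comul_apply φ a
    rw [h, ha, map_zero]
  rw [factor p hp, factor q hq, TensorProduct.map_comp, LinearMap.comp_apply, hc, map_zero,
    map_zero]

namespace FiniteDual

variable {L : Type*} [LieRing L] [LieAlgebra K L]

/-- Let `θ : C → U(L)°` and `φ : C → B` be morphisms of bialgebras with `φ` surjective. If the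
functionals `θ a` with `a` in `ker φ` vanish on `L`, then they vanish. -/
theorem eq_zero_of_forall_ι {C B : Type*} [CommRing C] [Bialgebra K C] [CommRing B]
    [Bialgebra K B] (θ : C →ₐc[K] FiniteDual K (UniversalEnvelopingAlgebra K L))
    (φ : C →ₐc[K] B) (hφ : Function.Surjective φ)
    (h : ∀ (x : L) (a : C), φ a = 0 → θ a (ι K x) = 0) (a : C) (ha : φ a = 0) : θ a = 0 := by
  -- Reverses the roles in the pairing: each `u` in `U(L)` becomes the linear form `c ↦ θ(c)(u)` on
  -- `C`.
  let ev : UniversalEnvelopingAlgebra K L → C →ₗ[K] K := fun u =>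
    (toDual.flip u) ∘ₗ θ.toCoalgHom.toLinearMap
  -- The product of `U(L)` becomes convolution of forms on `C`, because the comultiplication of
  -- `U(L)°` is dual to that product and `θ` respects comultiplications.
  have ev_mul : ∀ u v c, θ c (u * v) =
      LinearMap.mul' K K (TensorProduct.map (ev u) (ev v) (comul (R := K) c)) := by
    intro u v c
    rw [← pair₂_comul, ← CoalgHomClass.map_comp_comul_apply θ c]
    generalize comul (R := K) c = t
    induction t with
    | zero => simp
    | add s t hs ht => simp only [map_add, LinearMap.add_apply, hs, ht]
    | tmul s t => rw [TensorProduct.map_tmul, pair_tmul, TensorProduct.map_tmul]; rfl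
  -- Evaluation at `1` is the counit of `U(L)°`. Both `θ` and `φ` preserve counits, so the value is
  -- the counit of `B` at `φ c`.
  have ev_one : ∀ c, φ c = 0 → θ c 1 = 0 := by
    intro c hc
    rw [← counit_eq, CoalgHomClass.counit_comp_apply, ← CoalgHomClass.counit_comp_apply φ, hc,
      map_zero]
  -- The common zeros in `U(L)` of all functionals from `θ(ker φ)`. The induction over words in `L`
  -- is absorbed into the fact that `L` generates `U(L)`.
  let S : Subalgebra K (UniversalEnvelopingAlgebra K L) :=
    { carrier := {u | ∀ c, φ c = 0 → θ c u = 0}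
      mul_mem' := fun {u v} hu hv c hc => by
        rw [ev_mul]
        exact convolution_eq_zero_of_ker φ hφ (ev u) (ev v) hu hv c hc
      add_mem' := fun {u v} hu hv c hc => by
        refine (map_add (toDual (θ c)) u v).trans ?_
        rw [toDual_apply, toDual_apply, hu c hc, hv c hc, add_zero]
      algebraMap_mem' := fun r c hc => by
        rw [Algebra.algebraMap_eq_smul_one, apply_smul, ev_one c hc, mul_zero] }
  have hS : S = ⊤ := subalgebra_eq_top S fun x c hc => h x c hc
  ext u
  have hu : u ∈ S := hS ▸ Algebra.mem_top
  exact hu a ha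

end FiniteDual
end Density
end HopfDual

/-! ### Density of `χ` for group schemes -/

namespace AffineGroup
section Density
open AlgebraicGeometry CategoryTheory Opposite HopfDual HopfLie UniversalEnvelopingAlgebra

variable {K : Type u} [Field K]

/-- A morphism of group schemes is an isomorphism if the underlying morphism of schemes is. -/
theorem isIso_of_isIso_left {G H : GroupScheme K} (f : G ⟶ H) [h : IsIso f.hom.hom.left] :
    IsIso f := by
  -- The isomorphism is lifted from schemes to schemes over the base, then to monoid objects, then
  -- to group objects; each forgetful functor reflects isomorphisms.
  have h1 : IsIso ((Over.forget _).map f.hom.hom) := h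
  have h2 : IsIso f.hom.hom := isIso_of_reflects_iso f.hom.hom (Over.forget _)
  have h3 : IsIso ((Mon.forget _).map ((Grp.forget₂Mon _).map f)) := h2
  have h4 : IsIso ((Grp.forget₂Mon _).map f) := isIso_of_reflects_iso _ (Mon.forget _)
  exact isIso_of_reflects_iso f (Grp.forget₂Mon _)

/-- The underlying map is the canonical ring isomorphism from the global functions on `Spec A` to
`A`. It allows a function on `G(L)` to be shown zero by showing that its functional on `U(L)` is
zero. -/
theorem coordHopfSpec_injective (A : CommHopfAlgCat.{u} (CommRingCat.of K)) :
    Function.Injective (coordHopfSpec A).hom := by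
  intro a b hab
  exact (ConcreteCategory.bijective_of_isIso (Scheme.ΓSpecIso (CommRingCat.of A)).hom).1
    ((coordHopfSpec_apply A a).symm.trans (hab.trans (coordHopfSpec_apply A b)))

theorem chi_algebraicallyDense (L : Type u) [LieRing L] [LieAlgebra K L] :
    AlgebraicallyDense (chi K L) := by
  intro H _ i hi hρ
  -- A closed immersion into an affine scheme is surjective on global functions.
  have hsurj : Function.Surjective (comorphism i).hom := by
    intro b
    obtain ⟨a, ha⟩ := (IsClosedImmersion.isAffine_surjective_of_isAffine i.hom.hom.left).2 b
    exact ⟨a, (comorphism_apply i a).trans ha⟩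
  have hinj : Function.Injective i.hom.hom.left.appTop.hom := by
    rw [injective_iff_map_eq_zero]
    intro a ha
    refine (injective_iff_map_eq_zero (coordHopfSpec (envelopeHopf K L)).hom).mp
      (coordHopfSpec_injective (envelopeHopf K L)) a ?_
    -- Here `θ` is the identification of `O(G(L))` with `U(L)°` and `φ` is `i^*`, so only the
    -- vanishing on `L` of functionals from `ker i^*` remains.
    refine FiniteDual.eq_zero_of_forall_ι (coordHopfSpec (envelopeHopf K L)).hom
      (comorphism i).hom hsurj (fun x c hc => ?_) a ((comorphism_apply i a).trans ha)
    -- The hypothesis gives `χ(x) = d ∘ i^*` for some `d` in `Lie H`. Such a form kills `ker i^*`,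
    -- and `χ(x)(c)` is the value at `x` of the functional attached to `c`.
    obtain ⟨d, hd⟩ := hρ ⟨x, rfl⟩
    have hχ : (chi K L x).toLin c = 0 :=
      (congrArg (fun e : Lie (affineEnvelope K L) => e.toLin c) hd).symm.trans
        ((congrArg d.toLin hc).trans (map_zero d.toLin))
    exact (congrArg (fun f : FiniteDual K (UniversalEnvelopingAlgebra K L) => f (ι K x))
      (coordHopfSpec_apply (envelopeHopf K L) c)).trans ((chi_apply K L x c).symm.trans hχ)
  -- A closed immersion into an affine scheme is cut out by the kernel of its map on functions,
  -- which is now zero.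
  have : IsIso i.hom.hom.left := IsClosedImmersion.isIso_of_injective_of_isAffine hinj
  exact isIso_of_isIso_left i

end Density
end AffineGroup

theorem proposition4p6 (K : Type u) [Field K] [CharZero K]
    (L : Type u) [LieRing L] [LieAlgebra K L] :
    AffineGroup.AlgebraicallyDense (AffineGroup.chi K L) :=
  AffineGroup.chi_algebraicallyDense L
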